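/- Let $N\ge 0$ be an integer, $0\le a<b$ and $\gamma\in\mathbb{R}$. Let $z_1,\dots,z_N$ be independent random variables, each uniformly distributed on $[a,b]$ (the precisions of $N$ sensors), let $z_{[1]}\ge z_{[2]}\ge\dots\ge z_{[N]}$ be their values in descending order, and put $M_k=\sum_{i=1}^k z_{[i]}$. In the ordered scheme the sensors transmit in this order, and transmission stops as soon as the sum of the transmitted precisions is at least $\gamma$; the number of transmissions is $k^*=\min\{k\in\{0,\dots,N\}: M_k\ge\gamma\text{ or }k=N\}$. Then $k^*$ is integrable and $$\bar N_t^L\;\le\;E[k^*]\;\le\;\bar N_t^U .$$ The lower bound is $$\bar N_t^L=\sum_{k=0}^{N-1}F\!\left(\frac{\gamma}{k}\right)^{N},\qquad F(t)=\max\!\left(0,\min\!\left(1,\frac{t-a}{b-a}\right)\right),$$ where the term $k=0$ is $1$ if $\gamma>0$ and $0$ if $\gamma\le 0$. The upper bound is $$\bar N_t^U=\sum_{k=0}^{N-1}\frac{N!\left(\frac1{b-a}\right)^N}{(k!)^2\,(N-k-1)!}\sum_{j=0}^{k}(-1)^j\binom kj S_1(k,j),$$ where, with $0^0=1$, $$S_1(k,j)=\sum_{i=0}^{k}\binom{k}{i}(\gamma-bj)^i(j-k)^{k-i}\sum_{m=0}^{N-k-1}\binom{N-k-1}{m}(-a)^{N-k-1-m}\,\frac{c^{\,k-i+m+1}-a^{\,k-i+m+1}}{k-i+m+1}\quad\text{if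 }\gamma<kb,$$ $$S_1(k,j)=\sum_{i=0}^{N-k-1}\binom{N-k-1}{i}(k-j)^k(-a)^{N-k-1-i}\sum_{m=0}^{k}\binom{k}{m}b^m(-1)^{k-m}\,\frac{b^{\,k-m+i+1}-a^{\,k-m+i+1}}{k-m+i+1}\quad\text{if }\gamma\ge kb,$$ and $c=c(k,j)=\max\!\left(a,\min\!\left(\frac{\gamma-jb}{k-j},\frac{\gamma}{k}\right)\right)$ if $j<k$, $c=a$ if $j=k$. -/

import Mathlib

open MeasureTheory ProbabilityTheory

noncomputable section

/-- `orderedPrecision z i` is the value in position `i` (counted from `0`) when the values of `z`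
are arranged in descending order; so `orderedPrecision z 0` is the largest value. -/
def orderedPrecision {N : ℕ} (z : Fin N → ℝ) (i : Fin N) : ℝ :=
  z (Tuple.sort (fun j => OrderDual.toDual (z j)) i)

/-- The sum of the `k` largest values of `z` (of all of them if `k ≥ N`). -/
def topSum {N : ℕ} (z : Fin N → ℝ) (k : ℕ) : ℝ :=
  ∑ i : Fin N with i.val < k, orderedPrecision z i

/-- The number of transmissions of the ordered scheme: the least `k` for which the sum of the `k`
largest precisions is at least `γ`; if `γ` is never reached, all `N` sensors transmit. -/
def numTransmissions {N : ℕ} (γ : ℝ) (z : Fin N → ℝ) : ℕ :=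
  sInf {k : ℕ | γ ≤ topSum z k ∨ k = N}

/-- The distribution function of the uniform law on `[a, b]`. -/
def uniformCDF (a b t : ℝ) : ℝ := max 0 (min 1 ((t - a) / (b - a)))

/-- The lower bound `∑_{k < N} F(γ / k) ^ N`, where `F` is the distribution function of the uniform
law on `[a, b]`. In the term `k = 0`, `γ / 0` is read as `+∞` if `γ > 0` and as `-∞` otherwise. -/
def lowerBound (N : ℕ) (a b γ : ℝ) : ℝ :=
  ∑ k ∈ Finset.range N,
    if k = 0 then (if 0 < γ then 1 else 0) else uniformCDF a b (γ / k) ^ N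

/-- The upper end `c` of the interval `[a, c]` of integration in the case `γ < k b`, which is
`min ((γ - j b) / (k - j)) (γ / k)`. The interval is empty, and `c` is replaced by `a`, if that
number is smaller than `a` or if `j = k`, where the quotient by `k - j` is `-∞`. -/
def cutoff (a b γ : ℝ) (k j : ℕ) : ℝ :=
  if j < k then max a (min ((γ - j * b) / ((k : ℝ) - j)) (γ / k)) else a

/-- The closed form of the polynomial integral in the upper bound. -/
def S₁ (N : ℕ) (a b γ : ℝ) (k j : ℕ) : ℝ :=
  if γ < k * b then
    ∑ i ∈ Finset.range (k + 1),
      (k.choose i : ℝ) * (γ - b * j) ^ i * ((j : ℝ) - k) ^ (k - i) *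
        ∑ m ∈ Finset.range (N - k - 1 + 1),
          ((N - k - 1).choose m : ℝ) * (-a) ^ (N - k - 1 - m) *
            ((cutoff a b γ k j ^ (k - i + m + 1) - a ^ (k - i + m + 1)) /
              ((k - i + m + 1 : ℕ) : ℝ))
  else
    ∑ i ∈ Finset.range (N - k - 1 + 1),
      ((N - k - 1).choose i : ℝ) * ((k : ℝ) - j) ^ k * (-a) ^ (N - k - 1 - i) *
        ∑ m ∈ Finset.range (k + 1),
          (k.choose m : ℝ) * b ^ m * (-1) ^ (k - m) *
            ((b ^ (k - m + i + 1) - a ^ (k - m + i + 1)) / ((k - m + i + 1 : ℕ) : ℝ))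

/-- The upper bound on the expected number of transmissions. -/
def upperBound (N : ℕ) (a b γ : ℝ) : ℝ :=
  ∑ k ∈ Finset.range N,
    (N.factorial : ℝ) * (1 / (b - a)) ^ N /
        ((k.factorial : ℝ) ^ 2 * ((N - k - 1).factorial : ℝ)) *
      ∑ j ∈ Finset.range (k + 1), (-1) ^ j * (k.choose j : ℝ) * S₁ N a b γ k j

end

/-! By the tail-sum formula, E[k*] is the sum over k < N of P(k* > k), and k* > k means that M_l < γ
for all l ≤ k. Both bounds hold term by term.

Lower bound: if every precision is nonnegative and below γ/k, then each M_l with l ≤ k is below γ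
(`topSum_lt_of_forall_lt`), and by independence this has probability F(γ/k)^N.

Upper bound: drop all conditions but M_k < γ. Some pair (T, i) consists of the indices of k largest
values and the index of the next one. A union bound over the C(N,k)(N-k) pairs, with Fubini over the
value x of z_i, gives the integral of P(k variables are ≥ x with sum < γ) F(x)^(N-k-1)
(`measureReal_topSum_lt_le`). For the uniform law the first factor is an alternating sum of
truncated powers, as for the Irwin-Hall law (`toReal_upperTail_cond_Icc`). If γ < kb, integrating it
against the other factor gives the stated sums S₁. If γ ≥ kb, the sum constraint is void, and the
stated term is the same integral without it; it is at least 1 by the union bound itself. -/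

/-! ### Tail events of the number of transmissions -/

theorem numTransmissions_le {N : ℕ} (γ : ℝ) (z : Fin N → ℝ) : numTransmissions γ z ≤ N :=
  Nat.sInf_le (Or.inr rfl)

/-- All l ≤ k are needed, since `topSum z` is monotone only for nonnegative values, which are not
assumed here. -/
theorem lt_numTransmissions_iff {N k : ℕ} (γ : ℝ) (z : Fin N → ℝ) (hk : k < N) :
    k < numTransmissions γ z ↔ ∀ l ≤ k, topSum z l < γ := by
  constructor
  · intro h l hl
    have := Nat.notMem_of_lt_sInf (lt_of_le_of_lt hl h)
    simp only [Set.mem_ofPred_eq, not_or, not_le] at this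
    exact this.1
  · intro h
    by_contra hn
    have hmem : numTransmissions γ z ∈ {k : ℕ | γ ≤ topSum z k ∨ k = N} :=
      Nat.sInf_mem ⟨N, Or.inr rfl⟩
    rw [not_lt] at hn
    rcases hmem with h1 | h1
    · exact absurd (h _ hn) (not_lt.mpr h1)
    · omega

theorem numTransmissions_eq_sum_indicator {N : ℕ} (γ : ℝ) (z : Fin N → ℝ) :
    (numTransmissions γ z : ℝ) =
      ∑ k ∈ Finset.range N, {y : Fin N → ℝ | ∀ l ≤ k, topSum y l < γ}.indicator 1 z := by
  have h : ∀ k ∈ Finset.range N, {y : Fin N → ℝ | ∀ l ≤ k, topSum y l < γ}.indicator 1 z =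
      if k < numTransmissions γ z then (1 : ℝ) else 0 := by
    intro k hk
    rw [Set.indicator_apply]
    simp only [Set.mem_ofPred_eq, ← lt_numTransmissions_iff γ z (Finset.mem_range.mp hk),
      Pi.one_apply]
  rw [Finset.sum_congr rfl h, Finset.sum_boole]
  congr 1
  have : {x ∈ Finset.range N | x < numTransmissions γ z} =
      Finset.range (numTransmissions γ z) := by
    ext x
    have := numTransmissions_le γ z
    simp only [Finset.mem_filter, Finset.mem_range]
    omega
  rw [this, Finset.card_range]

/-! ### Measurability of the order statistics -/

/-- On each of the finitely many sets where the sorting permutation is constant, the order statistic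
is a coordinate. Such a set is cut out by comparisons of coordinates, including the tie-breaking
rule of `Tuple.sort`. -/
theorem measurable_orderedPrecision {N : ℕ} (i : Fin N) :
    Measurable fun z : Fin N → ℝ => orderedPrecision z i := by
  have hset : ∀ σ : Equiv.Perm (Fin N), MeasurableSet
      {z : Fin N → ℝ | Tuple.sort (fun j => OrderDual.toDual (z j)) = σ} := by
    intro σ
    have : {z : Fin N → ℝ | Tuple.sort (fun j => OrderDual.toDual (z j)) = σ} =
        {z : Fin N → ℝ | (∀ i j, i ≤ j → z (σ j) ≤ z (σ i)) ∧
          ∀ i j, i < j → z (σ i) = z (σ j) → σ i < σ j} := by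
      ext z
      simp only [Set.mem_ofPred_eq]
      rw [eq_comm, Tuple.eq_sort_iff]
      rfl
    rw [this]
    measurability
  have : (fun z : Fin N → ℝ => orderedPrecision z i) = fun z => ∑ σ : Equiv.Perm (Fin N),
      {z : Fin N → ℝ | Tuple.sort (fun j => OrderDual.toDual (z j)) = σ}.indicator
        (fun z => z (σ i)) z := by
    ext z
    simp only [Set.indicator_apply, Set.mem_ofPred_eq]
    rw [Finset.sum_ite_eq]
    simp [orderedPrecision]
  rw [this]
  exact Finset.measurable_sum _ fun σ _ => (measurable_pi_apply _).indicator (hset σ)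

theorem measurable_topSum {N : ℕ} (k : ℕ) : Measurable fun z : Fin N → ℝ => topSum z k := by
  unfold topSum
  exact Finset.measurable_sum _ fun i _ => measurable_orderedPrecision i

theorem measurableSet_topSum_lt {N : ℕ} (γ : ℝ) (k : ℕ) :
    MeasurableSet {z : Fin N → ℝ | topSum z k < γ} :=
  measurableSet_lt (measurable_topSum k) measurable_const

theorem measurableSet_forall_topSum_lt {N : ℕ} (γ : ℝ) (k : ℕ) :
    MeasurableSet {z : Fin N → ℝ | ∀ l ≤ k, topSum z l < γ} := by
  simp only [Set.ofPred_forall]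
  exact MeasurableSet.iInter fun l => MeasurableSet.iInter fun _ => measurableSet_topSum_lt γ l

/-! ### Top sets and their pivots -/

/-- The pairs of a set of `k` indices and one further index. -/
def topPairs (N k : ℕ) : Finset (Σ _ : Finset (Fin N), Fin N) :=
  (Finset.univ.powersetCard k).sigma fun T => Tᶜ

theorem mem_topPairs {N k : ℕ} {p : Σ _ : Finset (Fin N), Fin N} :
    p ∈ topPairs N k ↔ p.1.card = k ∧ p.2 ∉ p.1 := by
  simp [topPairs, Finset.mem_powersetCard]

theorem card_topPairs (N k : ℕ) : (topPairs N k).card = N.choose k * (N - k) := by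
  rw [topPairs, Finset.card_sigma, Finset.sum_congr rfl (g := fun _ => N - k)]
  · simp
  · intro T hT
    rw [Finset.card_compl, (Finset.mem_powersetCard.mp hT).2, Fintype.card_fin]

/-- Ties may allow several pairs; existence suffices for a union bound. -/
theorem exists_topPairs {N k : ℕ} (z : Fin N → ℝ) (hk : k < N) :
    ∃ p ∈ topPairs N k, (∀ j ∈ p.1, z p.2 ≤ z j) ∧ (∀ j ∉ p.1, z j ≤ z p.2) ∧
      ∑ j ∈ p.1, z j = topSum z k := by
  set σ := Tuple.sort (fun j => OrderDual.toDual (z j)) with hσ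
  have hmono : ∀ i j, i ≤ j → z (σ j) ≤ z (σ i) := fun i j hij =>
    Tuple.monotone_sort (fun j => OrderDual.toDual (z j)) hij
  refine ⟨⟨({i : Fin N | i.val < k} : Finset (Fin N)).map σ.toEmbedding, σ ⟨k, hk⟩⟩,
    mem_topPairs.mpr ⟨?_, ?_⟩, ?_, ?_, ?_⟩
  · simp only [Finset.card_map]
    rw [Fin.card_filter_val_lt]
    omega
  · simp
  · intro j hj
    simp only [Finset.mem_map, Finset.mem_filter, Finset.mem_univ, true_and,
      Equiv.coe_toEmbedding] at hj
    obtain ⟨i, hi, rfl⟩ := hj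
    exact hmono _ _ (Fin.le_def.mpr hi.le)
  · intro j hj
    obtain ⟨i, rfl⟩ := σ.surjective j
    simp only [Finset.mem_map, Finset.mem_filter, Finset.mem_univ, true_and,
      Equiv.coe_toEmbedding, EmbeddingLike.apply_eq_iff_eq, exists_eq_right, not_lt] at hj
    exact hmono _ _ (Fin.le_def.mpr hj)
  · simp [topSum, orderedPrecision, hσ]

theorem topSum_zero {N : ℕ} (z : Fin N → ℝ) : topSum z 0 = 0 := by simp [topSum]

theorem topSum_lt_of_forall_lt {N k l : ℕ} {γ : ℝ} (z : Fin N → ℝ) (hk : k < N) (hk0 : 0 < k)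
    (hl : l ≤ k) (hz0 : ∀ i, 0 ≤ z i) (hz : ∀ i, z i < γ / k) : topSum z l < γ := by
  have hk' : (0 : ℝ) < k := by exact_mod_cast hk0
  -- Since k < N, some coordinate exists; it forces γ > 0, which settles l = 0.
  have hpos : 0 < γ / k := (hz0 ⟨k, hk⟩).trans_lt (hz _)
  have hγ : 0 < γ := by
    have := mul_pos hpos hk'
    rwa [div_mul_cancel₀ _ hk'.ne'] at this
  obtain ⟨p, hp, -, -, hsum⟩ := exists_topPairs z (hl.trans_lt hk)
  rw [← hsum]
  have hcard := (mem_topPairs.mp hp).1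
  rcases Nat.eq_zero_or_pos l with rfl | hl0
  · rw [Finset.card_eq_zero] at hcard
    rw [hcard]
    simpa using hγ
  · have hne : p.1.Nonempty := Finset.card_pos.mp (by omega)
    calc ∑ j ∈ p.1, z j < ∑ _j ∈ p.1, γ / k := Finset.sum_lt_sum_of_nonempty hne fun i _ => hz i
      _ = l * (γ / k) := by rw [Finset.sum_const, hcard, nsmul_eq_mul]
      _ ≤ k * (γ / k) := by gcongr
      _ = γ := mul_div_cancel₀ _ hk'.ne'

/-! ### Conditioning on the pivot value -/

/-- The probability that `k` independent variables of law `μ` are all at least `x` and have a sum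
below `s`. -/
noncomputable def upperTail (μ : Measure ℝ) (k : ℕ) (x s : ℝ) : ENNReal :=
  Measure.pi (fun _ : Fin k => μ) {y | (∀ j, x ≤ y j) ∧ ∑ j, y j < s}

theorem measurableSet_upperTail (k : ℕ) :
    MeasurableSet {q : (ℝ × ℝ) × (Fin k → ℝ) | (∀ j, q.1.1 ≤ q.2 j) ∧ ∑ j, q.2 j < q.1.2} := by
  measurability

theorem measurable_upperTail (μ : Measure ℝ) [IsProbabilityMeasure μ] (k : ℕ) :
    Measurable fun q : ℝ × ℝ => upperTail μ k q.1 q.2 :=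
  measurable_measure_prodMk_left (measurableSet_upperTail k)

theorem upperTail_le_pow (μ : Measure ℝ) [IsProbabilityMeasure μ] (k : ℕ) (x s : ℝ) :
    upperTail μ k x s ≤ μ (Set.Ici x) ^ k := by
  have : μ (Set.Ici x) ^ k =
      Measure.pi (fun _ : Fin k => μ) (Set.univ.pi fun _ => Set.Ici x) := by
    rw [Measure.pi_pi]; simp
  rw [this]
  exact measure_mono fun y hy j _ => hy.1 j

theorem upperTail_ne_top (μ : Measure ℝ) [IsProbabilityMeasure μ] (k : ℕ) (x s : ℝ) :
    upperTail μ k x s ≠ ⊤ := measure_ne_top _ _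

theorem upperTail_zero (μ : Measure ℝ) [IsProbabilityMeasure μ] (x s : ℝ) :
    upperTail μ 0 x s = if 0 < s then 1 else 0 := by
  unfold upperTail
  split_ifs with h <;> simp [h]

/-- Fubini on the value y of the first variable; for y < x the slice is empty. -/
theorem upperTail_succ (μ : Measure ℝ) [IsProbabilityMeasure μ] (k : ℕ) (x s : ℝ) :
    upperTail μ (k + 1) x s = ∫⁻ y in Set.Ici x, upperTail μ k x (s - y) ∂μ := by
  have hmp := (measurePreserving_piFinSuccAbove (fun _ : Fin (k + 1) => μ) 0).symm
  have hms : MeasurableSet {y : Fin (k + 1) → ℝ | (∀ j, x ≤ y j) ∧ ∑ j, y j < s} :=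
    (measurableSet_upperTail (k + 1)).preimage
      (f := fun y : Fin (k + 1) → ℝ => ((x, s), y)) (by fun_prop)
  rw [upperTail, ← hmp.measure_preimage hms.nullMeasurableSet,
    Measure.prod_apply (hmp.measurable hms), ← lintegral_indicator measurableSet_Ici]
  refine lintegral_congr fun y => ?_
  rw [Set.indicator_apply]
  split_ifs with hy
  · unfold upperTail
    congr 1
    ext v
    simp only [MeasurableEquiv.piFinSuccAbove_symm_apply, Set.mem_preimage, Set.mem_ofPred_eq,
      Fin.forall_fin_succ, Fin.sum_univ_succ, Fin.insertNthEquiv_zero, Fin.consEquiv_apply,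
      Fin.cons_zero, Fin.cons_succ]
    constructor
    · rintro ⟨h1, h2⟩
      exact ⟨h1.2, by linarith⟩
    · rintro ⟨h1, h2⟩
      exact ⟨⟨hy, h1⟩, by linarith⟩
  · convert measure_empty (μ := Measure.pi fun _ : Fin k => μ)
    ext v
    simp only [Set.mem_preimage, Set.mem_empty_iff_false, iff_false]
    intro h
    exact hy (by simpa using h.1 0)

/-- The index type separates the pivot `none`, the k variables above it and the m below it. Once the
pivot equals x, the two blocks are independent and their probabilities multiply. -/
theorem measure_orderStat {Ω : Type*} [MeasurableSpace Ω] {P : Measure Ω} [IsProbabilityMeasure P]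
    {μ : Measure ℝ} [IsProbabilityMeasure μ] {k m : ℕ} {X : Option (Fin k ⊕ Fin m) → Ω → ℝ}
    (hX : ∀ o, Measurable (X o)) (hind : iIndepFun X P) (hlaw : ∀ o, P.map (X o) = μ) (γ : ℝ) :
    P {ω | ((∀ j, X none ω ≤ X (some (.inl j)) ω) ∧ ∑ j, X (some (.inl j)) ω < γ) ∧
      ∀ j, X (some (.inr j)) ω ≤ X none ω} =
      ∫⁻ x, upperTail μ k x γ * μ (Set.Iic x) ^ m ∂μ := by
  set B : Set (Option (Fin k ⊕ Fin m) → ℝ) :=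
    {w | ((∀ j, w none ≤ w (some (.inl j))) ∧ ∑ j, w (some (.inl j)) < γ) ∧
      ∀ j, w (some (.inr j)) ≤ w none} with hB
  have hBm : MeasurableSet B := by
    measurability
  have h1 := (iIndepFun_iff_map_fun_eq_pi_map fun o => (hX o).aemeasurable).mp hind
  simp only [hlaw] at h1
  have h2 : P {ω | ((∀ j, X none ω ≤ X (some (.inl j)) ω) ∧ ∑ j, X (some (.inl j)) ω < γ) ∧
      ∀ j, X (some (.inr j)) ω ≤ X none ω} = Measure.pi (fun _ => μ) B := by
    rw [← h1, Measure.map_apply (measurable_pi_lambda _ hX) hBm]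
    rfl
  rw [h2, ← Measure.pi_map_piOptionEquivProd (fun _ : Option (Fin k ⊕ Fin m) => μ),
    Measure.map_apply (MeasurableEquiv.measurable _) hBm,
    Measure.prod_apply_symm ((MeasurableEquiv.measurable _) hBm)]
  refine lintegral_congr fun x => ?_
  have hmp := measurePreserving_sumPiEquivProdPi_symm (fun _ : Fin k ⊕ Fin m => μ)
  rw [← hmp.measure_preimage (MeasurableSet.nullMeasurableSet
    (measurable_prodMk_right ((MeasurableEquiv.measurable _) hBm)))]
  have : μ (Set.Iic x) ^ m =
      Measure.pi (fun _ : Fin m => μ) (Set.univ.pi fun _ => Set.Iic x) := by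
    rw [Measure.pi_pi]; simp
  rw [this, upperTail, ← Measure.prod_prod]
  congr 1
  ext ⟨u, v⟩
  have hn : (MeasurableEquiv.piOptionEquivProd fun _ : Option (Fin k ⊕ Fin m) => ℝ).symm
      ((MeasurableEquiv.sumPiEquivProdPi fun _ => ℝ).symm (u, v), x) none = x := rfl
  have hl : ∀ j, (MeasurableEquiv.piOptionEquivProd fun _ : Option (Fin k ⊕ Fin m) => ℝ).symm
      ((MeasurableEquiv.sumPiEquivProdPi fun _ => ℝ).symm (u, v), x) (some (.inl j)) = u j :=
    fun _ => rfl
  have hr : ∀ j, (MeasurableEquiv.piOptionEquivProd fun _ : Option (Fin k ⊕ Fin m) => ℝ).symm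
      ((MeasurableEquiv.sumPiEquivProdPi fun _ => ℝ).symm (u, v), x) (some (.inr j)) = v j :=
    fun _ => rfl
  simp only [hB, Set.mem_preimage, Set.mem_ofPred_eq, hn, hl, hr, Set.mem_prod, Set.mem_pi,
    Set.mem_univ, true_imp_iff, Set.mem_Iic]

theorem measureReal_orderStat {Ω : Type*} [MeasurableSpace Ω] {P : Measure Ω}
    [IsProbabilityMeasure P] {μ : Measure ℝ} [IsProbabilityMeasure μ] {N k : ℕ}
    {z : Fin N → Ω → ℝ} (hz : ∀ i, Measurable (z i)) (hind : iIndepFun z P)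
    (hlaw : ∀ i, P.map (z i) = μ) (γ : ℝ) {p : Σ _ : Finset (Fin N), Fin N}
    (hp : p ∈ topPairs N k) :
    P.real {ω | ((∀ j ∈ p.1, z p.2 ω ≤ z j ω) ∧ ∑ j ∈ p.1, z j ω < γ) ∧
      ∀ j ∉ p.1, z j ω ≤ z p.2 ω} =
      ∫ x, (upperTail μ k x γ).toReal * μ.real (Set.Iic x) ^ (N - k - 1) ∂μ := by
  obtain ⟨T, i⟩ := p
  obtain ⟨hT, hi⟩ := mem_topPairs.mp hp
  simp only at hT hi ⊢
  have hR : (insert i T)ᶜ.card = N - k - 1 := by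
    rw [Finset.card_compl, Finset.card_insert_of_notMem hi, hT, Fintype.card_fin]
    omega
  set e := T.orderEmbOfFin hT
  set f := (insert i T)ᶜ.orderEmbOfFin hR
  have he : ∀ j, e j ∈ T := Finset.orderEmbOfFin_mem T hT
  have hf : ∀ j, f j ∈ (insert i T)ᶜ := Finset.orderEmbOfFin_mem _ hR
  simp only [Finset.mem_compl, Finset.mem_insert, not_or] at hf
  -- Enumerates pivot, top set and remaining indices; injectivity carries independence over to the
  -- reindexed family.
  set g : Option (Fin k ⊕ Fin (N - k - 1)) → Fin N := fun o => o.elim i (Sum.elim e f)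
  have hg : g.Injective := by
    rintro (_ | u | u) (_ | v | v) h
    · rfl
    · exact absurd (he v) (by rw [← show i = e v from h]; exact hi)
    · exact absurd (show i = f v from h).symm (hf v).1
    · exact absurd (he u) (by rw [show e u = i from h]; exact hi)
    · rw [e.injective (show e u = e v from h)]
    · exact absurd (he u) (by rw [show e u = f v from h]; exact (hf v).2)
    · exact absurd (show f u = i from h) (hf u).1
    · exact absurd (he v) (by rw [← show f u = e v from h]; exact (hf u).2)
    · rw [f.injective (show f u = f v from h)]
  have key := measure_orderStat (X := fun o => z (g o)) (fun o => hz _) (hind.precomp hg)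
    (fun o => hlaw _) γ
  have hset : {ω | ((∀ j ∈ T, z i ω ≤ z j ω) ∧ ∑ j ∈ T, z j ω < γ) ∧
      ∀ j ∉ T, z j ω ≤ z i ω} =
      {ω | ((∀ j, z (g none) ω ≤ z (g (some (.inl j))) ω) ∧
        ∑ j, z (g (some (.inl j))) ω < γ) ∧
        ∀ j, z (g (some (.inr j))) ω ≤ z (g none) ω} := by
    have hsum : ∀ ω, ∑ j ∈ T, z j ω = ∑ j, z (e j) ω := by
      intro ω
      have : T = Finset.univ.map e.toEmbedding := by
        simp [e]
      conv_lhs => rw [this]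
      rw [Finset.sum_map]
      rfl
    have hTe : ∀ j ∈ T, ∃ u, e u = j := by
      intro j hj
      have : j ∈ Set.range e := by rw [Finset.range_orderEmbOfFin]; exact hj
      exact this
    have hTf : ∀ j ∉ T, j ≠ i → ∃ u, f u = j := by
      intro j hj hji
      have : j ∈ Set.range f := by
        rw [Finset.range_orderEmbOfFin]
        simp [hj, hji]
      exact this
    ext ω
    simp only [Set.mem_ofPred_eq, hsum]
    refine and_congr (and_congr ⟨fun h j => h _ (he j), fun h j hj => ?_⟩ Iff.rfl)
      ⟨fun h j => h _ (hf j).2, fun h j hj => ?_⟩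
    · obtain ⟨u, rfl⟩ := hTe j hj
      exact h u
    · by_cases hji : j = i
      · rw [hji]
      · obtain ⟨u, rfl⟩ := hTf j hj hji
        exact h u
  have hm1 : Measurable fun x => upperTail μ k x γ :=
    (measurable_upperTail μ k).comp (by fun_prop : Measurable fun x : ℝ => (x, γ))
  have hm2 : Measurable fun x => μ (Set.Iic x) :=
    (Monotone.measurable fun x y hxy => measure_mono (Set.Iic_subset_Iic.mpr hxy))
  rw [hset, measureReal_def, key, ← integral_toReal]
  · simp [measureReal_def]
  · exact (hm1.mul (hm2.pow_const _)).aemeasurable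
  · exact Filter.Eventually.of_forall fun x => ENNReal.mul_lt_top
      (upperTail_ne_top μ k x γ).lt_top (ENNReal.pow_lt_top (measure_lt_top _ _))

theorem measureReal_topSum_lt_le {Ω : Type*} [MeasurableSpace Ω] {P : Measure Ω}
    [IsProbabilityMeasure P] {μ : Measure ℝ} [IsProbabilityMeasure μ] {N k : ℕ}
    {z : Fin N → Ω → ℝ} (hz : ∀ i, Measurable (z i)) (hind : iIndepFun z P)
    (hlaw : ∀ i, P.map (z i) = μ) (γ : ℝ) (hk : k < N) :
    P.real {ω | topSum (fun i => z i ω) k < γ} ≤ (N.choose k * (N - k) : ℕ) *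
      ∫ x, (upperTail μ k x γ).toReal * μ.real (Set.Iic x) ^ (N - k - 1) ∂μ := by
  calc P.real {ω | topSum (fun i => z i ω) k < γ}
      ≤ P.real (⋃ p ∈ topPairs N k, {ω | ((∀ j ∈ p.1, z p.2 ω ≤ z j ω) ∧
          ∑ j ∈ p.1, z j ω < γ) ∧ ∀ j ∉ p.1, z j ω ≤ z p.2 ω}) := by
        refine measureReal_mono (fun ω hω => ?_) (measure_ne_top _ _)
        obtain ⟨p, hp, h1, h2, h3⟩ := exists_topPairs (fun i => z i ω) hk
        simp only [Set.mem_iUnion]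
        exact ⟨p, hp, ⟨h1, h3.trans_lt hω⟩, h2⟩
    _ ≤ ∑ p ∈ topPairs N k, P.real {ω | ((∀ j ∈ p.1, z p.2 ω ≤ z j ω) ∧
          ∑ j ∈ p.1, z j ω < γ) ∧ ∀ j ∉ p.1, z j ω ≤ z p.2 ω} :=
        measureReal_biUnion_finset_le _ _
    _ = _ := by
        rw [Finset.sum_congr rfl fun p hp => measureReal_orderStat hz hind hlaw γ hp,
          Finset.sum_const, card_topPairs, nsmul_eq_mul]

/-! ### The uniform law on an interval -/

theorem setIntegral_Ici_cond_Icc {a b x : ℝ} (hab : a < b) (hax : a ≤ x) (hxb : x ≤ b)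
    (f : ℝ → ℝ) :
    ∫ y in Set.Ici x, f y ∂(cond volume (Set.Icc a b)) = (b - a)⁻¹ * ∫ y in x..b, f y := by
  have hset : Set.Ici x ∩ Set.Icc a b = Set.Icc x b := by
    ext y
    simp only [Set.mem_inter_iff, Set.mem_Ici, Set.mem_Icc]
    exact ⟨fun h => ⟨h.1, h.2.2⟩, fun h => ⟨h.1, hax.trans h.1, h.2⟩⟩
  rw [ProbabilityTheory.cond, Measure.restrict_smul, integral_smul_measure,
    Measure.restrict_restrict measurableSet_Ici, hset, integral_Icc_eq_integral_Ioc,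
    ← intervalIntegral.integral_of_le hxb, Real.volume_Icc, smul_eq_mul, ENNReal.toReal_inv,
    ENNReal.toReal_ofReal (sub_nonneg.mpr hab.le)]

theorem isProbabilityMeasure_cond_Icc {a b : ℝ} (hab : a < b) :
    IsProbabilityMeasure (cond (volume : Measure ℝ) (Set.Icc a b)) :=
  cond_isProbabilityMeasure_of_finite (by simp [hab]) (by simp)

theorem ae_mem_cond_Icc {a b : ℝ} :
    ∀ᵐ x ∂(cond (volume : Measure ℝ) (Set.Icc a b)), x ∈ Set.Icc a b :=
  ae_cond_mem measurableSet_Icc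

theorem integral_cond_Icc {a b : ℝ} (hab : a < b) (f : ℝ → ℝ) :
    ∫ y, f y ∂(cond volume (Set.Icc a b)) = (b - a)⁻¹ * ∫ y in a..b, f y := by
  rw [← setIntegral_Ici_cond_Icc hab le_rfl hab.le, Measure.restrict_eq_self_of_ae_mem]
  filter_upwards [ae_mem_cond_Icc] with x hx using hx.1

theorem cond_Icc_real_Ici {a b x : ℝ} (hab : a < b) (hax : a ≤ x) (hxb : x ≤ b) :
    (cond volume (Set.Icc a b)).real (Set.Ici x) = (b - x) / (b - a) := by
  have := setIntegral_Ici_cond_Icc hab hax hxb fun _ => 1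
  simp only [integral_const, MeasurableSet.univ, measureReal_restrict_apply, Set.univ_inter,
    smul_eq_mul, mul_one, intervalIntegral.integral_const] at this
  rw [this, div_eq_inv_mul]

theorem cond_Icc_real_Iio {a b t : ℝ} (hab : a < b) :
    (cond volume (Set.Icc a b)).real (Set.Iio t) = uniformCDF a b t := by
  have hba : 0 < b - a := sub_pos.mpr hab
  rw [measureReal_def, cond_apply measurableSet_Icc, Real.volume_Icc, uniformCDF]
  rcases le_or_gt t b with htb | htb
  · have : Set.Icc a b ∩ Set.Iio t = Set.Ico a t := by
      ext y
      simp only [Set.mem_inter_iff, Set.mem_Icc, Set.mem_Iio, Set.mem_Ico]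
      exact ⟨fun h => ⟨h.1.1, h.2⟩, fun h => ⟨⟨h.1, h.2.le.trans htb⟩, h.2⟩⟩
    rw [this, Real.volume_Ico, ENNReal.toReal_mul, ENNReal.toReal_inv,
      ENNReal.toReal_ofReal hba.le,
      min_eq_right ((div_le_one hba).mpr (by linarith)), ← div_eq_inv_mul]
    rcases le_or_gt a t with hat | hat
    · rw [ENNReal.toReal_ofReal (sub_nonneg.mpr hat), max_eq_right]
      exact div_nonneg (sub_nonneg.mpr hat) hba.le
    · rw [ENNReal.ofReal_of_nonpos (by linarith), max_eq_left]
      · simp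
      · exact div_nonpos_of_nonpos_of_nonneg (by linarith) hba.le
  · have : Set.Icc a b ∩ Set.Iio t = Set.Icc a b :=
      Set.inter_eq_left.mpr fun y hy => hy.2.trans_lt htb
    rw [this, Real.volume_Icc, min_eq_left ((one_le_div hba).mpr (by linarith)),
      ENNReal.inv_mul_cancel]
    · simp
    · simpa using hab
    · simp

theorem cond_Icc_real_Iic {a b x : ℝ} (hab : a < b) (hax : a ≤ x) (hxb : x ≤ b) :
    (cond volume (Set.Icc a b)).real (Set.Iic x) = (x - a) / (b - a) := by
  have hac : cond (volume : Measure ℝ) (Set.Icc a b) {x} = 0 :=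
    cond_absolutelyContinuous (measure_singleton x)
  have : Set.Iio x =ᵐ[cond volume (Set.Icc a b)] Set.Iic x := Iio_ae_eq_Iic' hac
  have hba : 0 < b - a := sub_pos.mpr hab
  rw [← measureReal_congr this, cond_Icc_real_Iio hab, uniformCDF,
    min_eq_right ((div_le_one hba).mpr (by linarith)), max_eq_right]
  exact div_nonneg (sub_nonneg.mpr hax) hba.le

/-! ### Truncated powers and the closed form of the upper tail -/

/-- The truncated power `t₊ ^ k`, where `0₊ ^ 0` is read as `0`. -/
noncomputable def truncPow (k : ℕ) (t : ℝ) : ℝ := if 0 < t then t ^ k else 0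

theorem truncPow_eq_max {k : ℕ} (hk : k ≠ 0) (t : ℝ) : truncPow k t = max t 0 ^ k := by
  unfold truncPow
  split_ifs with h
  · rw [max_eq_left h.le]
  · rw [max_eq_right (not_lt.mp h), zero_pow hk]

theorem truncPow_of_nonpos {k : ℕ} {t : ℝ} (ht : t ≤ 0) : truncPow k t = 0 :=
  if_neg (not_lt.mpr ht)

theorem continuous_truncPow {k : ℕ} (hk : k ≠ 0) : Continuous (truncPow k) := by
  rw [show truncPow k = fun t => max t 0 ^ k from funext (truncPow_eq_max hk)]
  fun_prop

theorem monotone_truncPow (k : ℕ) : Monotone (truncPow k) := by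
  intro s t hst
  unfold truncPow
  split_ifs with h1 h2
  · gcongr
  · exact absurd (h1.trans_le hst) h2
  · positivity
  · rfl

/-- Monotonicity replaces continuity, which fails at k = 0. -/
theorem intervalIntegrable_truncPow (k : ℕ) {p q : ℝ} (hq : 0 ≤ q) (x y : ℝ) :
    IntervalIntegrable (fun t => truncPow k (p - q * t)) volume x y := by
  refine Antitone.intervalIntegrable fun s t hst => monotone_truncPow k ?_
  nlinarith [mul_le_mul_of_nonneg_left hst hq]

theorem hasDerivAt_truncPow {k : ℕ} {t : ℝ} (ht : t ≠ 0) :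
    HasDerivAt (truncPow (k + 1)) ((k + 1) * truncPow k t) t := by
  rcases ht.lt_or_gt with h | h
  · rw [truncPow_of_nonpos h.le, mul_zero]
    refine (hasDerivAt_const t (0 : ℝ)).congr_of_eventuallyEq ?_
    filter_upwards [gt_mem_nhds h] with y hy using truncPow_of_nonpos (le_of_lt hy)
  · rw [truncPow, if_pos h]
    have := hasDerivAt_pow (k + 1) t
    simp only [Nat.add_sub_cancel, Nat.cast_add, Nat.cast_one] at this
    refine this.congr_of_eventuallyEq ?_
    filter_upwards [lt_mem_nhds h] with y hy using if_pos hy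

theorem integral_truncPow (k : ℕ) (u x b : ℝ) :
    ∫ y in x..b, truncPow k (u - y) =
      (truncPow (k + 1) (u - x) - truncPow (k + 1) (u - b)) / (k + 1) := by
  have hk : (k + 1 : ℝ) ≠ 0 := by positivity
  have hint : IntervalIntegrable (fun y => truncPow k (u - y)) volume x b := by
    simpa using intervalIntegrable_truncPow k (p := u) zero_le_one x b
  -- The antiderivative is continuous, and differentiable except perhaps at the kink y = u.
  rw [integral_eq_of_hasDerivAt_off_countable
    (fun y => -(truncPow (k + 1) (u - y) / (k + 1))) _ (Set.countable_singleton u) ?_ ?_ hint]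
  · ring
  · exact (((continuous_truncPow (Nat.succ_ne_zero k)).comp (by fun_prop)).div_const
      _).neg.continuousOn
  · intro y hy
    have hne : u - y ≠ 0 := sub_ne_zero.mpr fun h => hy.2 h.symm
    have := (((hasDerivAt_truncPow (k := k) hne).comp y
      ((hasDerivAt_id y).const_sub u)).div_const (k + 1 : ℝ)).neg
    convert this using 1
    · rfl
    · field_simp

/-- Pascal's rule, in the form that matches the difference of endpoint values in
`integral_truncPow`. -/
theorem sum_alternating_choose_succ (A : ℕ → ℝ) (k : ℕ) :
    ∑ j ∈ Finset.range (k + 2), (-1) ^ j * ((k + 1).choose j : ℝ) * A j =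
      ∑ j ∈ Finset.range (k + 1), (-1) ^ j * (k.choose j : ℝ) * (A j - A (j + 1)) := by
  have h : ∑ j ∈ Finset.range (k + 1), (-1) ^ j * (k.choose j : ℝ) * A j =
      ∑ j ∈ Finset.range (k + 1), (-1) ^ (j + 1) * (k.choose (j + 1) : ℝ) * A (j + 1) + A 0 := by
    have := Finset.sum_range_succ' (fun j => (-1) ^ j * (k.choose j : ℝ) * A j) (k + 1)
    rw [Finset.sum_range_succ] at this
    simpa using this
  rw [Finset.sum_range_succ']
  simp only [mul_sub, Finset.sum_sub_distrib, h, Nat.choose_succ_succ, Nat.cast_add]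
  simp only [Nat.choose_zero_right, Nat.cast_one, pow_zero, one_mul, mul_add, add_mul,
    Finset.sum_add_distrib, pow_succ, mul_neg, neg_mul, mul_one, Finset.sum_neg_distrib]
  ring

/-- This is the k-th forward difference of t^k at 0, with the summation reversed. -/
theorem sum_alternating_choose_pow (k : ℕ) :
    ∑ j ∈ Finset.range (k + 1), (-1) ^ j * (k.choose j : ℝ) * ((k : ℝ) - j) ^ k =
      k.factorial := by
  have h := congrFun (fwdDiff_iter_eq_factorial (R := ℝ) (n := k)) 0
  rw [fwdDiff_iter_eq_sum_shift] at h
  rw [← Finset.sum_range_reflect]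
  simp only [Nat.add_sub_cancel]
  rw [Pi.natCast_apply] at h
  rw [← h]
  refine Finset.sum_congr rfl fun j hj => ?_
  have hj' : j ≤ k := Nat.lt_succ_iff.mp (Finset.mem_range.mp hj)
  rw [Nat.choose_symm hj', Nat.cast_sub hj']
  simp

/-- Induction on k through `upperTail_succ`: integrating a truncated power over [x, b] gives a
difference of two of the next degree, with j and j + 1 upper endpoints used, and Pascal's rule
recombines them. The base case is where 0₊^0 = 0 encodes the strict inequality. -/
theorem toReal_upperTail_cond_Icc {a b x : ℝ} (hab : a < b) (hax : a ≤ x) (hxb : x ≤ b) (k : ℕ)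
    (s : ℝ) :
    (upperTail (cond volume (Set.Icc a b)) k x s).toReal =
      (b - a)⁻¹ ^ k / k.factorial * ∑ j ∈ Finset.range (k + 1),
        (-1) ^ j * (k.choose j : ℝ) * truncPow k (s - j * b - ((k : ℝ) - j) * x) := by
  have := isProbabilityMeasure_cond_Icc hab
  induction k generalizing s with
  | zero =>
    rw [upperTail_zero]
    simp only [truncPow]
    split_ifs <;> simp_all
  | succ k ih =>
    have hm : Measurable fun y => upperTail (cond volume (Set.Icc a b)) k x (s - y) :=
      (measurable_upperTail _ k).comp (by fun_prop : Measurable fun y : ℝ => (x, s - y))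
    rw [upperTail_succ, ← integral_toReal hm.aemeasurable
      (Filter.Eventually.of_forall fun y => (upperTail_ne_top _ _ _ _).lt_top)]
    simp only [ih]
    rw [setIntegral_Ici_cond_Icc hab hax hxb, intervalIntegral.integral_const_mul,
      intervalIntegral.integral_finsetSum]
    · rw [sum_alternating_choose_succ, Nat.factorial_succ, Finset.mul_sum, Finset.mul_sum,
        Finset.mul_sum]
      refine Finset.sum_congr rfl fun j hj => ?_
      have h1 : (fun y => (-1) ^ j * (k.choose j : ℝ) *
          truncPow k (s - y - j * b - ((k : ℝ) - j) * x)) = fun y =>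
          (-1) ^ j * (k.choose j : ℝ) * truncPow k ((s - j * b - ((k : ℝ) - j) * x) - y) := by
        ext y
        congr 2
        ring
      rw [h1, intervalIntegral.integral_const_mul, integral_truncPow]
      push_cast
      have h2 : s - j * b - ((k : ℝ) - j) * x - x = s - j * b - ((k : ℝ) + 1 - j) * x := by ring
      have h3 : s - j * b - ((k : ℝ) - j) * x - b =
          s - (j + 1) * b - ((k : ℝ) + 1 - (j + 1)) * x := by ring
      rw [h2, h3]
      have : (k.factorial : ℝ) ≠ 0 := by positivity
      have : (k + 1 : ℝ) ≠ 0 := by positivity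
      field_simp
      ring
    · intro j _
      have h1 : (fun y => (-1) ^ j * (k.choose j : ℝ) *
          truncPow k (s - y - j * b - ((k : ℝ) - j) * x)) = fun y =>
          (-1) ^ j * (k.choose j : ℝ) *
            truncPow k ((s - j * b - ((k : ℝ) - j) * x) - 1 * y) := by
        ext y
        congr 2
        ring
      rw [h1]
      exact (intervalIntegrable_truncPow k zero_le_one x b).const_mul _

/-! ### The polynomial integrals and the terms of the upper bound -/

theorem integral_pow_mul_pow (k n : ℕ) (p q r a c : ℝ) :
    ∫ x in a..c, (p + q * x) ^ k * (x + r) ^ n =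
      ∑ i ∈ Finset.range (k + 1), (k.choose i : ℝ) * p ^ i * q ^ (k - i) *
        ∑ m ∈ Finset.range (n + 1), (n.choose m : ℝ) * r ^ (n - m) *
          ((c ^ (k - i + m + 1) - a ^ (k - i + m + 1)) / ((k - i + m + 1 : ℕ) : ℝ)) := by
  have h : ∀ x : ℝ, (p + q * x) ^ k * (x + r) ^ n =
      ∑ i ∈ Finset.range (k + 1), ∑ m ∈ Finset.range (n + 1),
        ((k.choose i : ℝ) * p ^ i * q ^ (k - i) * ((n.choose m : ℝ) * r ^ (n - m))) *
          x ^ (k - i + m) := by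
    intro x
    rw [add_pow, add_pow, Finset.sum_mul_sum]
    refine Finset.sum_congr rfl fun i _ => Finset.sum_congr rfl fun m _ => ?_
    rw [mul_pow, pow_add]
    ring
  simp only [h]
  rw [intervalIntegral.integral_finsetSum
    fun i _ => Continuous.intervalIntegrable (by fun_prop) _ _]
  refine Finset.sum_congr rfl fun i _ => ?_
  rw [intervalIntegral.integral_finsetSum
    fun i _ => Continuous.intervalIntegrable (by fun_prop) _ _, Finset.mul_sum]
  refine Finset.sum_congr rfl fun m _ => ?_
  rw [intervalIntegral.integral_const_mul, integral_pow]
  push_cast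
  ring

/-- For j < k the truncated power vanishes beyond u = (γ - jb)/(k - j) and is a polynomial before
it, so the integral stops at the cutoff. -/
theorem S₁_eq_integral_of_lt {N k j : ℕ} {a b γ : ℝ} (hab : a < b) (ha : 0 ≤ a) (hj : j ≤ k)
    (hγ : γ < k * b) :
    S₁ N a b γ k j =
      ∫ x in a..b, truncPow k (γ - j * b - ((k : ℝ) - j) * x) * (x - a) ^ (N - k - 1) := by
  have hS : S₁ N a b γ k j = ∫ x in a..cutoff a b γ k j,
      ((γ - b * j) + ((j : ℝ) - k) * x) ^ k * (x + -a) ^ (N - k - 1) := by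
    rw [integral_pow_mul_pow, S₁, if_pos hγ]
  rw [hS]
  rcases hj.lt_or_eq with hjk | rfl
  · have hb : 0 < b := ha.trans_lt hab
    have hd : (0 : ℝ) < (k : ℝ) - j := sub_pos.mpr (by exact_mod_cast hjk)
    have hk0 : (0 : ℝ) < k := by exact_mod_cast (by omega : 0 < k)
    have hk : k ≠ 0 := by omega
    -- By γ < kb, the minimum in `cutoff` is always its first entry.
    have hmin : (γ - j * b) / ((k : ℝ) - j) ≤ γ / k := by
      rw [div_le_div_iff₀ hd hk0]
      nlinarith [mul_le_mul_of_nonneg_left hγ.le (Nat.cast_nonneg j : (0 : ℝ) ≤ j)]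
    set u := (γ - j * b) / ((k : ℝ) - j) with hu
    have hud : u * ((k : ℝ) - j) = γ - j * b := div_mul_cancel₀ _ hd.ne'
    have hub : u ≤ b := by
      rw [hu, div_le_iff₀ hd]
      nlinarith
    have hc : cutoff a b γ k j = max a u := by
      rw [cutoff, if_pos hjk, min_eq_left hmin]
    have hcb : max a u ≤ b := max_le hab.le hub
    have hcont : Continuous fun x =>
        truncPow k (γ - j * b - ((k : ℝ) - j) * x) * (x - a) ^ (N - k - 1) :=
      ((continuous_truncPow hk).comp (by fun_prop)).mul (by fun_prop)
    rw [hc, ← intervalIntegral.integral_add_adjacent_intervals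
      (hcont.intervalIntegrable a (max a u)) (hcont.intervalIntegrable (max a u) b)]
    have h0 : ∫ x in (max a u)..b,
        truncPow k (γ - j * b - ((k : ℝ) - j) * x) * (x - a) ^ (N - k - 1) = 0 := by
      rw [intervalIntegral.integral_congr (g := fun _ => 0), intervalIntegral.integral_zero]
      intro x hx
      rw [Set.uIcc_of_le hcb] at hx
      have : u ≤ x := (le_max_right _ _).trans hx.1
      simp only
      rw [truncPow_of_nonpos (by nlinarith), zero_mul]
    rw [h0, add_zero]
    rcases le_total u a with hua | hau
    · rw [max_eq_left hua, intervalIntegral.integral_same, intervalIntegral.integral_same]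
    · rw [max_eq_right hau]
      refine intervalIntegral.integral_congr fun x hx => ?_
      rw [Set.uIcc_of_le hau] at hx
      rw [truncPow_eq_max hk, max_eq_left (by nlinarith [hx.2])]
      ring
  · rw [cutoff, if_neg (lt_irrefl _), intervalIntegral.integral_same]
    have h0 : γ - j * b ≤ 0 := by linarith
    simp [truncPow_of_nonpos h0]

theorem S₁_eq_integral_of_le {N k j : ℕ} {a b γ : ℝ} (hγ : k * b ≤ γ) :
    S₁ N a b γ k j =
      ((k : ℝ) - j) ^ k * ∫ x in a..b, (b - x) ^ k * (x - a) ^ (N - k - 1) := by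
  have h : ∫ x in a..b, (b - x) ^ k * (x - a) ^ (N - k - 1) =
      ∫ x in a..b, (b + (-1) * x) ^ k * (x + -a) ^ (N - k - 1) := by
    refine intervalIntegral.integral_congr fun x _ => ?_
    ring
  rw [h, integral_pow_mul_pow, S₁, if_neg (not_lt.mpr hγ)]
  simp only [Finset.mul_sum]
  rw [Finset.sum_comm]
  refine Finset.sum_congr rfl fun m _ => Finset.sum_congr rfl fun i _ => ?_
  ring

/-- The term of index `k` of `upperBound`. -/
noncomputable def upperTerm (N : ℕ) (a b γ : ℝ) (k : ℕ) : ℝ :=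
  (N.factorial : ℝ) * (1 / (b - a)) ^ N /
      ((k.factorial : ℝ) ^ 2 * ((N - k - 1).factorial : ℝ)) *
    ∑ j ∈ Finset.range (k + 1), (-1) ^ j * (k.choose j : ℝ) * S₁ N a b γ k j

theorem choose_mul_sub_eq {N k : ℕ} (hk : k < N) :
    ((N.choose k * (N - k) : ℕ) : ℝ) = N.factorial / (k.factorial * (N - k - 1).factorial) := by
  rw [eq_div_iff (by positivity)]
  have h1 := Nat.choose_mul_factorial_mul_factorial hk.le
  have h2 : (N - k).factorial = (N - k) * (N - k - 1).factorial :=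
    (Nat.mul_factorial_pred (by omega)).symm
  rw [← h1, h2]
  push_cast
  ring

theorem upperTerm_eq_of_lt {N k : ℕ} {a b γ : ℝ} (ha : 0 ≤ a) (hab : a < b) (hk : k < N)
    (hγ : γ < k * b) :
    (N.choose k * (N - k) : ℕ) * ∫ x, (upperTail (cond volume (Set.Icc a b)) k x γ).toReal *
      (cond volume (Set.Icc a b)).real (Set.Iic x) ^ (N - k - 1) ∂(cond volume (Set.Icc a b)) =
      upperTerm N a b γ k := by
  have hba : b - a ≠ 0 := (sub_pos.mpr hab).ne'
  have hcongr : ∫ x in a..b, (upperTail (cond volume (Set.Icc a b)) k x γ).toReal *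
      (cond volume (Set.Icc a b)).real (Set.Iic x) ^ (N - k - 1) =
      ∫ x in a..b, ((b - a)⁻¹ ^ (N - 1) / k.factorial) * ∑ j ∈ Finset.range (k + 1),
        (-1) ^ j * (k.choose j : ℝ) *
          (truncPow k (γ - j * b - ((k : ℝ) - j) * x) * (x - a) ^ (N - k - 1)) := by
    refine intervalIntegral.integral_congr fun x hx => ?_
    rw [Set.uIcc_of_le hab.le] at hx
    rw [toReal_upperTail_cond_Icc hab hx.1 hx.2, cond_Icc_real_Iic hab hx.1 hx.2,
      Finset.mul_sum, Finset.mul_sum, Finset.sum_mul]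
    refine Finset.sum_congr rfl fun j _ => ?_
    -- The upper tail supplies k factors (b - a)⁻¹ and the lower variables N - k - 1; the N-th comes
    -- from the density of the pivot.
    rw [show N - 1 = k + (N - k - 1) by omega, pow_add, div_pow, div_eq_mul_inv _ ((b - a) ^ _),
      inv_pow (b - a) (N - k - 1)]
    ring
  rw [integral_cond_Icc hab, hcongr, intervalIntegral.integral_const_mul,
    intervalIntegral.integral_finsetSum, choose_mul_sub_eq hk, upperTerm]
  · have hsum : ∑ j ∈ Finset.range (k + 1), ∫ x in a..b, (-1) ^ j * (k.choose j : ℝ) *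
          (truncPow k (γ - j * b - ((k : ℝ) - j) * x) * (x - a) ^ (N - k - 1)) =
        ∑ j ∈ Finset.range (k + 1), (-1) ^ j * (k.choose j : ℝ) * S₁ N a b γ k j := by
      refine Finset.sum_congr rfl fun j hj => ?_
      rw [intervalIntegral.integral_const_mul,
        S₁_eq_integral_of_lt hab ha (Nat.lt_succ_iff.mp (Finset.mem_range.mp hj)) hγ]
    have hpow : (1 / (b - a)) ^ N = (b - a)⁻¹ * (b - a)⁻¹ ^ (N - 1) := by
      rw [one_div, ← pow_succ', Nat.sub_add_cancel (by omega)]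
    rw [hsum, hpow]
    ring
  · intro j hj
    have hj' : (0 : ℝ) ≤ (k : ℝ) - j :=
      sub_nonneg.mpr (by exact_mod_cast Nat.lt_succ_iff.mp (Finset.mem_range.mp hj))
    exact ((intervalIntegrable_truncPow k hj' a b).mul_continuousOn
      (by fun_prop)).const_mul _

/-- Here j enters S₁ only through (k - j)^k, so the alternating sum yields k!, cancelling one factor
of (k!)². -/
theorem upperTerm_eq_of_le {N k : ℕ} {a b γ : ℝ} (hab : a < b) (hk : k < N) (hγ : k * b ≤ γ) :
    upperTerm N a b γ k =
      (N.choose k * (N - k) : ℕ) * ∫ x, (cond volume (Set.Icc a b)).real (Set.Ici x) ^ k *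
        (cond volume (Set.Icc a b)).real (Set.Iic x) ^ (N - k - 1)
          ∂(cond volume (Set.Icc a b)) := by
  have hcongr : ∫ x in a..b, (cond volume (Set.Icc a b)).real (Set.Ici x) ^ k *
      (cond volume (Set.Icc a b)).real (Set.Iic x) ^ (N - k - 1) =
      ∫ x in a..b, (b - a)⁻¹ ^ (N - 1) * ((b - x) ^ k * (x - a) ^ (N - k - 1)) := by
    refine intervalIntegral.integral_congr fun x hx => ?_
    rw [Set.uIcc_of_le hab.le] at hx
    rw [cond_Icc_real_Ici hab hx.1 hx.2, cond_Icc_real_Iic hab hx.1 hx.2,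
      show N - 1 = k + (N - k - 1) by omega, pow_add, div_eq_mul_inv, div_eq_mul_inv, mul_pow,
      mul_pow]
    ring
  have hpow : (1 / (b - a)) ^ N = (b - a)⁻¹ * (b - a)⁻¹ ^ (N - 1) := by
    rw [one_div, ← pow_succ', Nat.sub_add_cancel (by omega)]
  rw [integral_cond_Icc hab, hcongr, intervalIntegral.integral_const_mul, choose_mul_sub_eq hk,
    upperTerm, hpow]
  simp only [S₁_eq_integral_of_le hγ, ← mul_assoc]
  rw [← Finset.sum_mul, sum_alternating_choose_pow]
  have : (k.factorial : ℝ) ≠ 0 := by positivity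
  field_simp

/-! ### Termwise bounds on the tail probabilities -/

section

variable {Ω : Type*} [MeasurableSpace Ω] {P : Measure Ω} {N : ℕ}
  {a b : ℝ} {z : Fin N → Ω → ℝ}

theorem ae_forall_mem_Icc (hmeas : ∀ i, Measurable (z i))
    (hlaw : ∀ i, P.map (z i) = cond volume (Set.Icc a b)) :
    ∀ᵐ ω ∂P, ∀ i, z i ω ∈ Set.Icc a b := by
  rw [ae_all_iff]
  intro i
  refine ae_of_ae_map (hmeas i).aemeasurable ?_
  rw [hlaw i]
  exact ae_mem_cond_Icc

theorem topSum_le_mul {k : ℕ} (y : Fin N → ℝ) (hk : k < N) (hy : ∀ i, y i ≤ b) :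
    topSum y k ≤ k * b := by
  obtain ⟨p, hp, -, -, hsum⟩ := exists_topPairs y hk
  rw [← hsum, ← (mem_topPairs.mp hp).1, ← nsmul_eq_mul]
  exact Finset.sum_le_card_nsmul _ _ _ fun i _ => hy i

theorem measureReal_topSum_lt_le_upperTerm [IsProbabilityMeasure P] (ha : 0 ≤ a) (hab : a < b)
    (hmeas : ∀ i, Measurable (z i)) (hindep : iIndepFun z P)
    (hlaw : ∀ i, P.map (z i) = cond volume (Set.Icc a b)) (γ : ℝ) {k : ℕ} (hk : k < N) :
    P.real {ω | topSum (fun i => z i ω) k < γ} ≤ upperTerm N a b γ k := by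
  have hμ := isProbabilityMeasure_cond_Icc hab
  rcases lt_or_ge γ (k * b) with hγ | hγ
  · rw [← upperTerm_eq_of_lt ha hab hk hγ]
    exact measureReal_topSum_lt_le hmeas hindep hlaw γ hk
  -- The threshold kb + 1 is almost surely not reached. The union bound at this threshold shows that
  -- the term is at least 1, so no Beta integral has to be evaluated.
  · have hone : P.real {ω | topSum (fun i => z i ω) k < k * b + 1} = 1 := by
      refine (measureReal_congr (Filter.eventuallyEq_univ.mpr ?_)).trans probReal_univ
      filter_upwards [ae_forall_mem_Icc hmeas hlaw] with ω hω
      exact (topSum_le_mul _ hk fun i => (hω i).2).trans_lt (lt_add_one _)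
    calc P.real {ω | topSum (fun i => z i ω) k < γ} ≤ 1 := measureReal_le_one
      _ = P.real {ω | topSum (fun i => z i ω) k < k * b + 1} := hone.symm
      _ ≤ _ := measureReal_topSum_lt_le hmeas hindep hlaw _ hk
      _ ≤ _ := by
        rw [upperTerm_eq_of_le hab hk hγ]
        refine mul_le_mul_of_nonneg_left (integral_mono_of_nonneg
          (Filter.Eventually.of_forall fun x => by positivity) ?_
          (Filter.Eventually.of_forall fun x => ?_)) (Nat.cast_nonneg _)
        · have h1 : Measurable fun x => (cond volume (Set.Icc a b)).real (Set.Ici x) :=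
            Antitone.measurable fun x y hxy => measureReal_mono (Set.Ici_subset_Ici.mpr hxy)
          have h2 : Measurable fun x => (cond volume (Set.Icc a b)).real (Set.Iic x) :=
            Monotone.measurable fun x y hxy => measureReal_mono (Set.Iic_subset_Iic.mpr hxy)
          refine Integrable.of_bound
            ((h1.pow_const _).mul (h2.pow_const _)).aestronglyMeasurable 1
            (Filter.Eventually.of_forall fun x => ?_)
          rw [Real.norm_of_nonneg (by positivity)]
          exact mul_le_one₀ (pow_le_one₀ measureReal_nonneg measureReal_le_one) (by positivity)
            (pow_le_one₀ measureReal_nonneg measureReal_le_one)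
        · refine mul_le_mul_of_nonneg_right ?_ (by positivity)
          rw [measureReal_def, ← ENNReal.toReal_pow]
          exact ENNReal.toReal_mono (ENNReal.pow_ne_top (measure_ne_top _ _))
            (upperTail_le_pow _ _ _ _)

theorem measureReal_forall_lt (hab : a < b)
    (hmeas : ∀ i, Measurable (z i)) (hindep : iIndepFun z P)
    (hlaw : ∀ i, P.map (z i) = cond volume (Set.Icc a b)) (t : ℝ) :
    P.real {ω | ∀ i, z i ω < t} = uniformCDF a b t ^ N := by
  have hset : {ω | ∀ i, z i ω < t} = ⋂ i, z i ⁻¹' Set.Iio t := by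
    ext ω
    simp
  rw [hset, measureReal_def, hindep.meas_iInter fun i => ⟨Set.Iio t, measurableSet_Iio, rfl⟩,
    ENNReal.toReal_prod]
  have : ∀ i, (P (z i ⁻¹' Set.Iio t)).toReal = uniformCDF a b t := by
    intro i
    rw [← Measure.map_apply (hmeas i) measurableSet_Iio, hlaw i, ← measureReal_def,
      cond_Icc_real_Iio hab]
  simp [this]

theorem lowerTerm_le_measureReal [IsProbabilityMeasure P] (ha : 0 ≤ a) (hab : a < b)
    (hmeas : ∀ i, Measurable (z i)) (hindep : iIndepFun z P)
    (hlaw : ∀ i, P.map (z i) = cond volume (Set.Icc a b)) (γ : ℝ) {k : ℕ} (hk : k < N) :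
    (if k = 0 then (if 0 < γ then 1 else 0) else uniformCDF a b (γ / k) ^ N) ≤
      P.real {ω | ∀ l ≤ k, topSum (fun i => z i ω) l < γ} := by
  split_ifs with hk0 hγ
  · have : {ω | ∀ l ≤ k, topSum (fun i => z i ω) l < γ} = Set.univ := by
      refine Set.eq_univ_of_forall fun ω l hl => ?_
      rw [show l = 0 by omega, topSum_zero]
      exact hγ
    rw [this, probReal_univ]
  · exact measureReal_nonneg
  · rw [← measureReal_forall_lt hab hmeas hindep hlaw]
    -- The inclusion holds only almost surely, since it needs nonnegative precisions.
    refine ENNReal.toReal_mono (measure_ne_top _ _) (measure_mono_ae ?_)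
    filter_upwards [ae_forall_mem_Icc hmeas hlaw] with ω hω h l hl
    exact topSum_lt_of_forall_lt _ hk (Nat.pos_of_ne_zero hk0) hl
      (fun i => ha.trans (hω i).1) h

end

theorem theorem1 {Ω : Type*} [MeasurableSpace Ω] (P : Measure Ω) [IsProbabilityMeasure P]
    (N : ℕ) (a b γ : ℝ) (ha : 0 ≤ a) (hab : a < b)
    (z : Fin N → Ω → ℝ) (hmeas : ∀ i, Measurable (z i))
    (hindep : iIndepFun z P)
    (hunif : ∀ i, pdf.IsUniform (z i) (Set.Icc a b) P volume) :
    Integrable (fun ω => (numTransmissions γ (fun i => z i ω) : ℝ)) P ∧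
      lowerBound N a b γ ≤ ∫ ω, (numTransmissions γ (fun i => z i ω) : ℝ) ∂P ∧
      ∫ ω, (numTransmissions γ (fun i => z i ω) : ℝ) ∂P ≤ upperBound N a b γ := by
  have hlaw : ∀ i, P.map (z i) = cond volume (Set.Icc a b) := hunif
  have hA : ∀ k, MeasurableSet {ω | ∀ l ≤ k, topSum (fun i => z i ω) l < γ} := fun k =>
    measurable_pi_lambda (fun ω i => z i ω) hmeas (measurableSet_forall_topSum_lt γ k)
  have hnum : (fun ω => (numTransmissions γ (fun i => z i ω) : ℝ)) = fun ω =>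
      ∑ k ∈ Finset.range N,
        {ω | ∀ l ≤ k, topSum (fun i => z i ω) l < γ}.indicator (1 : Ω → ℝ) ω := by
    ext ω
    exact numTransmissions_eq_sum_indicator γ fun i => z i ω
  have hint : ∀ k ∈ Finset.range N, Integrable
      ({ω | ∀ l ≤ k, topSum (fun i => z i ω) l < γ}.indicator (1 : Ω → ℝ)) P := fun k _ =>
    (integrable_const (1 : ℝ)).indicator (hA k)
  have hE : ∫ ω, (numTransmissions γ (fun i => z i ω) : ℝ) ∂P =
      ∑ k ∈ Finset.range N, P.real {ω | ∀ l ≤ k, topSum (fun i => z i ω) l < γ} := by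
    rw [hnum, integral_finsetSum _ hint]
    exact Finset.sum_congr rfl fun k _ => integral_indicator_one (hA k)
  refine ⟨?_, ?_, ?_⟩
  · rw [hnum]
    exact integrable_finsetSum _ hint
  · rw [hE, lowerBound]
    exact Finset.sum_le_sum fun k hk =>
      lowerTerm_le_measureReal ha hab hmeas hindep hlaw γ (Finset.mem_range.mp hk)
  · rw [hE]
    change _ ≤ ∑ k ∈ Finset.range N, upperTerm N a b γ k
    refine Finset.sum_le_sum fun k hk => le_trans ?_
      (measureReal_topSum_lt_le_upperTerm ha hab hmeas hindep hlaw γ (Finset.mem_range.mp hk))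
    -- Only the condition l = k is kept.
    exact measureReal_mono fun ω hω => hω k le_rfl
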